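/- Let $(W,S)$ be a Coxeter system with $S=\{s_1,\dots,s_n\}$ finite (the $s_i$ pairwise distinct, numbered in an arbitrary order), and let $u=s_1\cdots s_n$ be the corresponding Coxeter element, that is, the product of all the generators in $S$, each occurring exactly once. Let $\ell$ denote the word length on $W$ with respect to $S$. Call an element $w\in W$ straight if $\ell(w^k)=k\,\ell(w)$ for all $k\in\mathbb{N}$. The irreducible components of $W$ are the subgroups $W_I=\langle I\rangle$ where $I\subseteq S$ runs over the vertex sets of the connected components of the Coxeter diagram of $(W,S)$. Then $u$ is straight if and only if every irreducible component of $W$ is infinite. -/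

import Mathlib

/-- The graph underlying the Coxeter diagram: vertices are the indices of the simple reflections,
and two distinct indices are joined when the corresponding entry of the Coxeter matrix is not `2`
(the entry `0` encodes infinity, so it also gives an edge). -/
def CoxeterMatrix.diagramGraph {B : Type*} (M : CoxeterMatrix B) : SimpleGraph B where
  Adj i j := i ≠ j ∧ M i j ≠ 2
  symm := ⟨fun i j h => ⟨h.1.symm, by rw [M.symmetric j i]; exact h.2⟩⟩
  loopless := ⟨fun _ h => h.1 rfl⟩

/-- The standard parabolic subgroup generated by the simple reflections indexed by `I`. -/
def CoxeterSystem.standardParabolic {B W : Type*} [Group W] {M : CoxeterMatrix B}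
    (cs : CoxeterSystem M W) (I : Set B) : Subgroup W :=
  Subgroup.closure (cs.simple '' I)

/-- Every irreducible component of the Coxeter system, that is, every standard parabolic subgroup
generated by a connected component of the Coxeter diagram, is infinite. -/
def CoxeterSystem.HasOnlyInfiniteComponents {B W : Type*} [Group W] {M : CoxeterMatrix B}
    (cs : CoxeterSystem M W) : Prop :=
  ∀ C : M.diagramGraph.ConnectedComponent, Infinite (cs.standardParabolic C.supp)

/-- An element `w` is straight if `ℓ(w ^ n) = n * ℓ(w)` for all natural numbers `n`. -/
def CoxeterSystem.IsStraight {B W : Type*} [Group W] {M : CoxeterMatrix B}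
    (cs : CoxeterSystem M W) (w : W) : Prop :=
  ∀ n : ℕ, cs.length (w ^ n) = n * cs.length w

/-- A Coxeter element is a product of all the simple reflections, each occurring exactly once, in
some order. In particular, its existence forces the index set `B` to be finite. -/
def CoxeterSystem.IsCoxeterElement {B W : Type*} [Group W] {M : CoxeterMatrix B}
    (cs : CoxeterSystem M W) (u : W) : Prop :=
  ∃ ω : List B, ω.Nodup ∧ (∀ i : B, i ∈ ω) ∧ cs.wordProd ω = u

/-!
Every enumeration `l` of the simple reflections carries a skew-symmetric form `Ω_l` on the root
space, and applying the first reflection of `l` turns `Ω_l` into the form of the rotated word; in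
particular the Coxeter element preserves `Ω_l`. This is the form used by Speyer in *Powers of
Coxeter elements in infinite groups are reduced*.

Among the prefixes of the periodic words `l l l ⋯`, for all enumerations `l`, suppose that a
shortest non-reduced one is `w s_j`, and let `i` be its first letter. Minimality forces
`w α_j = -α_i`, and invariance gives `-Ω_l(α_i, γ) = Ω_l'(α_j, w⁻¹ γ)`, where `l'` is the rotation
of `l` starting with `j`. If `γ` and `w⁻¹ γ` are both positive roots, then the left side is `≤ 0`
and the right side is `≥ 0`, so `γ` has coefficient `0` at all neighbours of `i`. Since `w⁻¹` makes
only finitely many positive roots negative, the roots of the component of `i` are finite in number,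
hence so is the component.

Conversely, the part of a Coxeter element lying in a finite component commutes with the rest and
becomes trivial in a suitable power, which is therefore too short.
-/

namespace GeometricRepresentation

section ReflectionProducts

open Polynomial.Chebyshev

theorem eval_S_sub_one_two_mul_cos_pi_div {k : ℕ} (hk : 2 ≤ k) :
    (S ℝ (k - 1)).eval (2 * Real.cos (Real.pi / k)) = 0 := by
  have hk' : (2 : ℝ) ≤ k := by exact_mod_cast hk
  have hsin : Real.sin (Real.pi / k) ≠ 0 :=
    (Real.sin_pos_of_pos_of_lt_pi (by positivity)
      (div_lt_self Real.pi_pos (by linarith))).ne'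
  refine (mul_eq_zero_iff_right hsin).1 ?_
  rw [S_two_mul_real_cos]
  push_cast
  rw [sub_add_cancel, mul_div_cancel₀ _ (by linarith), Real.sin_pi]

theorem eval_S_add_eval_S_sub_one_two_mul_cos {k : ℕ} (hk : 1 ≤ k) :
    (S ℝ k).eval (2 * Real.cos (2 * Real.pi / (2 * k + 1))) +
      (S ℝ (k - 1)).eval (2 * Real.cos (2 * Real.pi / (2 * k + 1))) = 0 := by
  have hk' : (1 : ℝ) ≤ k := by exact_mod_cast hk
  have hpi := Real.pi_pos
  set φ := 2 * Real.pi / (2 * k + 1 : ℝ) with hφ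
  have hsin : Real.sin φ ≠ 0 := by
    refine (Real.sin_pos_of_pos_of_lt_pi (by positivity) ?_).ne'
    rw [hφ, div_lt_iff₀ (by linarith)]
    nlinarith
  have hkφ : (k + 1) * φ = 2 * Real.pi - k * φ := by
    rw [hφ]
    field_simp
    ring
  refine (mul_eq_zero_iff_right hsin).1 ?_
  rw [add_mul, S_two_mul_real_cos, S_two_mul_real_cos]
  push_cast
  rw [sub_add_cancel, hkφ, Real.sin_two_pi_sub, neg_add_cancel]

variable {V : Type*} [AddCommGroup V] [Module ℝ V] {x y : V} {f g : Module.Dual ℝ V}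

theorem reflection_mul_reflection_sq_of_orthogonal (hf : f x = 2) (hg : g y = 2)
    (hfy : f y = 0) (hgx : g x = 0) :
    (Module.reflection hf * Module.reflection hg) ^ 2 = 1 := by
  ext z
  simp only [pow_two, LinearEquiv.mul_apply, Module.reflection_apply, map_sub, map_smul, hf, hg,
    hfy, hgx, LinearEquiv.coe_one, id_eq]
  module

theorem reflection_mul_reflection_pow_eq_one (hf : f x = 2) (hg : g y = 2) {m : ℕ} (hm : 3 ≤ m)
    (h : f y * g x = 4 * Real.cos (Real.pi / m) ^ 2) :
    (Module.reflection hf * Module.reflection hg) ^ m = 1 := by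
  have ht : 2 * Real.cos (2 * Real.pi / m) = f y * g x - 2 := by
    rw [h, mul_div_assoc, Real.cos_two_mul]
    ring
  ext z
  rw [Module.reflection_mul_reflection_pow_apply hf hg m z _ ht]
  obtain ⟨k, rfl | rfl⟩ := Nat.even_or_odd' m
  · have h₁ : (((2 * k : ℕ) : ℤ) - 2) / 2 = k - 1 := by lia
    have h₂ : (((2 * k : ℕ) : ℤ) - 1) / 2 = k - 1 := by lia
    have hS : (S ℝ (k - 1)).eval (2 * Real.cos (2 * Real.pi / (2 * k : ℕ))) = 0 := by
      rw [Nat.cast_mul, Nat.cast_two, mul_div_mul_left _ _ two_ne_zero]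
      exact eval_S_sub_one_two_mul_cos_pi_div (by lia)
    rw [h₁, h₂, hS]
    simp
  · have h₁ : (((2 * k + 1 : ℕ) : ℤ) - 1) / 2 = k := by lia
    have h₂ : (((2 * k + 1 : ℕ) : ℤ) - 2) / 2 = k - 1 := by lia
    have h₃ : (((2 * k + 1 : ℕ) : ℤ) - 3) / 2 = k - 1 := by lia
    have h₄ : ((2 * k + 1 : ℕ) : ℤ) / 2 = k := by lia
    have hS := eval_S_add_eval_S_sub_one_two_mul_cos (k := k) (by lia)
    rw [h₁, h₂, h₃, h₄]
    push_cast
    simp [hS]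

end ReflectionProducts

variable {B W : Type*} [Group W] {M : CoxeterMatrix B}

section Cartan

/-- The entries `-2 cos (π / M i j)` of the Cartan matrix of a Coxeter matrix, normalized so that
all roots have the same length. An entry `M i j = 0`, which encodes infinity, gives the value `-2`
because `π / 0 = 0`. -/
noncomputable def cartan (M : CoxeterMatrix B) (i j : B) : ℝ := -2 * Real.cos (Real.pi / M i j)

theorem cartan_symm (i j : B) : cartan M i j = cartan M j i := by
  rw [cartan, cartan, M.symmetric]

@[simp] theorem cartan_self (i : B) : cartan M i i = 2 := by
  simp [cartan]

theorem cartan_eq_zero_of_eq_two {i j : B} (h : M i j = 2) : cartan M i j = 0 := by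
  simp [cartan, h]

theorem cartan_neg_of_adj {i j : B} (h : M.diagramGraph.Adj i j) : cartan M i j < 0 := by
  suffices 0 < Real.cos (Real.pi / M i j) by rw [cartan]; linarith
  obtain h₀ | h₃ : M i j = 0 ∨ 3 ≤ M i j := by
    have := M.off_diagonal i j h.1
    have := h.2
    lia
  · simp [h₀]
  · have hpi := Real.pi_pos
    have h₃' : (2 : ℝ) < M i j := by exact_mod_cast h₃
    exact Real.cos_pos_of_mem_Ioo ⟨by linarith [show 0 ≤ Real.pi / M i j by positivity],
      div_lt_div_of_pos_left hpi two_pos h₃'⟩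

theorem cartan_nonpos {i j : B} (h : i ≠ j) : cartan M i j ≤ 0 := by
  by_cases h₂ : M i j = 2
  · exact (cartan_eq_zero_of_eq_two h₂).le
  · exact (cartan_neg_of_adj ⟨h, h₂⟩).le

/-- The simple root `α_i`, a basis vector of the space on which the geometric representation
acts. -/
noncomputable abbrev simpleRoot (i : B) : B →₀ ℝ := Finsupp.single i 1

/-- The simple coroot of index `i`: the linear form taking the value `cartan M i j` on `α_j`. -/
noncomputable def coroot (M : CoxeterMatrix B) (i : B) : Module.Dual ℝ (B →₀ ℝ) :=
  Finsupp.linearCombination ℝ (cartan M i)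

@[simp] theorem coroot_simpleRoot (i j : B) : coroot M i (simpleRoot j) = cartan M i j := by
  simp [coroot]

theorem coroot_simpleRoot_self (i : B) : coroot M i (simpleRoot i) = 2 := by
  simp

theorem coroot_neg_of_adj {x : B →₀ ℝ} (hx : 0 ≤ x) {i j : B} (hi : x i = 0) (hj : x j ≠ 0)
    (hij : M.diagramGraph.Adj i j) : coroot M i x < 0 := by
  rw [coroot, Finsupp.linearCombination_apply]
  refine Finset.sum_neg' (fun k _ => ?_) ⟨j, Finsupp.mem_support_iff.2 hj, ?_⟩
  · obtain rfl | hk := eq_or_ne i k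
    · simp [hi]
    · exact mul_nonpos_of_nonneg_of_nonpos (hx k) (cartan_nonpos hk)
  · exact mul_neg_of_pos_of_neg ((hx j).lt_of_ne' hj) (cartan_neg_of_adj hij)

/-- The symmetric bilinear form of a Coxeter matrix, with Gram matrix `cartan M` in the simple
roots. -/
noncomputable def bilinForm (M : CoxeterMatrix B) : LinearMap.BilinForm ℝ (B →₀ ℝ) :=
  Finsupp.linearCombination ℝ (coroot M)

@[simp] theorem bilinForm_simpleRoot (i : B) : bilinForm M (simpleRoot i) = coroot M i := by
  simp [bilinForm]

theorem bilinForm_comm (x y : B →₀ ℝ) : bilinForm M x y = bilinForm M y x := by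
  suffices h : bilinForm M = (bilinForm M).flip from LinearMap.congr_fun₂ h x y
  ext i j
  simpa using cartan_symm i j

/-- The reflection in the simple root of index `i`. -/
noncomputable def simpleReflection (M : CoxeterMatrix B) (i : B) :
    (B →₀ ℝ) ≃ₗ[ℝ] (B →₀ ℝ) :=
  Module.reflection (coroot_simpleRoot_self (M := M) i)

theorem simpleReflection_apply (i : B) (x : B →₀ ℝ) :
    simpleReflection M i x = x - coroot M i x • simpleRoot i :=
  rfl

theorem simpleReflection_apply_of_ne {i j : B} (h : j ≠ i) (x : B →₀ ℝ) :
    simpleReflection M i x j = x j := by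
  simp [simpleReflection_apply, h.symm]

theorem simpleReflection_apply_self (i : B) (x : B →₀ ℝ) :
    simpleReflection M i x i = x i - coroot M i x := by
  simp [simpleReflection_apply]

@[simp] theorem simpleReflection_simpleRoot_self (i : B) :
    simpleReflection M i (simpleRoot i) = -simpleRoot i :=
  Module.reflection_apply_self _

@[simp] theorem simpleReflection_simpleReflection (i : B) (x : B →₀ ℝ) :
    simpleReflection M i (simpleReflection M i x) = x :=
  Module.involutive_reflection (coroot_simpleRoot_self i) x

theorem bilinForm_simpleReflection (i : B) (x y : B →₀ ℝ) :
    bilinForm M (simpleReflection M i x) (simpleReflection M i y) = bilinForm M x y := by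
  have hx : bilinForm M x (simpleRoot i) = coroot M i x := by
    rw [bilinForm_comm, bilinForm_simpleRoot]
  simp only [simpleReflection_apply, map_sub, map_smul, LinearMap.sub_apply, LinearMap.smul_apply,
    bilinForm_simpleRoot, coroot_simpleRoot_self, hx, smul_eq_mul]
  ring

theorem isLiftable_simpleReflection : M.IsLiftable (simpleReflection M) := by
  intro i j
  obtain rfl | hij := eq_or_ne i j
  · ext1 x
    simp
  obtain h₀ | h₂ | h₃ : M i j = 0 ∨ M i j = 2 ∨ 3 ≤ M i j := by
    have := M.off_diagonal i j hij
    lia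
  · simp [h₀]
  · rw [h₂]
    exact reflection_mul_reflection_sq_of_orthogonal _ _
      (by rw [coroot_simpleRoot, cartan_eq_zero_of_eq_two h₂])
      (by rw [coroot_simpleRoot, cartan_symm, cartan_eq_zero_of_eq_two h₂])
  · refine reflection_mul_reflection_pow_eq_one _ _ h₃ ?_
    rw [coroot_simpleRoot, coroot_simpleRoot, cartan_symm j i, cartan]
    ring

end Cartan

section Words

open CoxeterSystem

variable (cs : CoxeterSystem M W)

theorem isReduced_concat_iff (ω : List B) (i : B) :
    cs.IsReduced (ω ++ [i]) ↔ cs.IsReduced ω ∧ ¬cs.IsRightDescent (cs.wordProd ω) i := by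
  have hω := cs.length_wordProd_le ω
  have hi := cs.length_mul_simple (cs.wordProd ω) i
  rw [CoxeterSystem.IsReduced, CoxeterSystem.IsReduced, cs.not_isRightDescent_iff,
    cs.wordProd_append, cs.wordProd_singleton, List.length_append,
    List.length_singleton]
  lia

theorem isReduced_of_length_mul_wordProd {w : W} {ω : List B}
    (h : cs.length (w * cs.wordProd ω) = cs.length w + ω.length) : cs.IsReduced ω := by
  have hmul := cs.length_mul_le w (cs.wordProd ω)
  have hω := cs.length_wordProd_le ω
  rw [CoxeterSystem.IsReduced]
  lia

theorem exists_eq_mul_alternatingWord {w : W} {i : B} (hi : ¬cs.IsRightDescent w i) (j : B) :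
    ∃ v k, w = v * cs.wordProd (alternatingWord i j k) ∧ cs.length w = cs.length v + k ∧
      ¬cs.IsRightDescent v i ∧ ¬cs.IsRightDescent v j := by
  induction h : cs.length w generalizing w i j with
  | zero =>
    obtain rfl := cs.length_eq_zero_iff.1 h
    exact ⟨1, 0, by simp [alternatingWord], by simp, cs.not_isRightDescent_one i,
      cs.not_isRightDescent_one j⟩
  | succ n ih =>
    by_cases hj : cs.IsRightDescent w j
    · obtain ⟨v, k, hv, hlen, hvj, hvi⟩ :=
        ih (cs.isRightDescent_iff_not_isRightDescent_mul.1 hj) i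
          (by rw [cs.isRightDescent_iff] at hj; lia)
      refine ⟨v, k + 1, ?_, by lia, hvi, hvj⟩
      rw [alternatingWord_succ, cs.wordProd_concat, ← mul_assoc, ← hv,
        cs.simple_mul_simple_cancel_right]
    · exact ⟨w, 0, by simp [alternatingWord], by simp [h], hi, hj⟩

theorem succ_le_of_length_mul_alternatingWord {v : W} {i j : B} {k : ℕ}
    (hi : ¬cs.IsRightDescent (v * cs.wordProd (alternatingWord i j k)) i)
    (hlen : cs.length (v * cs.wordProd (alternatingWord i j k)) = cs.length v + k)
    (hM : M i j ≠ 0) : k + 1 ≤ M i j := by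
  rw [cs.not_isRightDescent_iff, mul_assoc, ← cs.wordProd_concat, ← alternatingWord_succ, hlen,
    add_assoc] at hi
  by_contra! hlt
  rw [M.symmetric] at hM hlt
  have hred : cs.IsReduced (alternatingWord j i (k + 1)) :=
    isReduced_of_length_mul_wordProd cs (w := v) (by rw [hi, length_alternatingWord])
  exact cs.not_isReduced_alternatingWord j i hM hlt hred

theorem wordProd_mem_standardParabolic (ω : List B) :
    cs.wordProd ω ∈ cs.standardParabolic {i | i ∈ ω} := by
  refine Subgroup.list_prod_mem _ fun x hx => ?_
  obtain ⟨i, hi, rfl⟩ := List.mem_map.1 hx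
  exact Subgroup.subset_closure ⟨i, hi, rfl⟩

theorem wordProd_flatten_replicate (ω : List B) (m : ℕ) :
    cs.wordProd (List.replicate m ω).flatten = cs.wordProd ω ^ m := by
  simp [wordProd, List.map_flatten, List.prod_flatten]

end Words

section DihedralRoots

open Polynomial.Chebyshev

theorem eval_S_neg_cartan_nonneg {i j : B} (hij : i ≠ j) {k : ℕ} (hk : M i j ≠ 0 → k ≤ M i j) :
    0 ≤ (S ℝ (k - 1)).eval (-cartan M i j) := by
  have hcos : -cartan M i j = 2 * Real.cos (Real.pi / M i j) := by simp [cartan]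
  rw [hcos]
  obtain h₀ | h₂ : M i j = 0 ∨ 2 ≤ M i j := by
    have := M.off_diagonal i j hij
    lia
  · simp [h₀]
  have hpi := Real.pi_pos
  have h₂' : (2 : ℝ) ≤ M i j := by exact_mod_cast h₂
  have hk' : (k : ℝ) ≤ M i j := by exact_mod_cast hk (by lia)
  have hsin : 0 < Real.sin (Real.pi / M i j) :=
    Real.sin_pos_of_pos_of_lt_pi (by positivity) (div_lt_self hpi (by linarith))
  refine nonneg_of_mul_nonneg_left ?_ hsin
  rw [S_two_mul_real_cos]
  push_cast
  rw [sub_add_cancel]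
  refine Real.sin_nonneg_of_nonneg_of_le_pi (by positivity) ?_
  rw [mul_div_assoc', div_le_iff₀ (by linarith), mul_comm]
  gcongr

end DihedralRoots

section GeometricRep

open CoxeterSystem Polynomial.Chebyshev

variable (cs : CoxeterSystem M W)

/-- The geometric representation of a Coxeter group, sending each simple reflection of the group
to the reflection in the corresponding simple root. -/
noncomputable def geometricRep : W →* ((B →₀ ℝ) ≃ₗ[ℝ] (B →₀ ℝ)) :=
  cs.lift ⟨simpleReflection M, isLiftable_simpleReflection⟩

@[simp] theorem geometricRep_simple (i : B) :
    geometricRep cs (cs.simple i) = simpleReflection M i :=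
  cs.lift_apply_simple _ i

theorem geometricRep_mul_apply (v w : W) (x : B →₀ ℝ) :
    geometricRep cs (v * w) x = geometricRep cs v (geometricRep cs w x) := by
  simp

theorem geometricRep_inv_apply_apply (w : W) (x : B →₀ ℝ) :
    geometricRep cs w⁻¹ (geometricRep cs w x) = x := by
  rw [← geometricRep_mul_apply, inv_mul_cancel, map_one, LinearEquiv.coe_one, id]

theorem geometricRep_apply_inv_apply (w : W) (x : B →₀ ℝ) :
    geometricRep cs w (geometricRep cs w⁻¹ x) = x := by
  rw [← geometricRep_mul_apply, mul_inv_cancel, map_one, LinearEquiv.coe_one, id]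

theorem geometricRep_mul_simple_simpleRoot (w : W) (i : B) :
    geometricRep cs (w * cs.simple i) (simpleRoot i) = -geometricRep cs w (simpleRoot i) := by
  rw [geometricRep_mul_apply, geometricRep_simple, simpleReflection_simpleRoot_self, map_neg]

theorem bilinForm_geometricRep (w : W) (x y : B →₀ ℝ) :
    bilinForm M (geometricRep cs w x) (geometricRep cs w y) = bilinForm M x y := by
  induction w using cs.simple_induction_left with
  | one => simp
  | mul_simple_left w i ih =>
    rw [geometricRep_mul_apply, geometricRep_mul_apply, geometricRep_simple,
      bilinForm_simpleReflection, ih]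

theorem geometricRep_alternatingWord_simpleRoot (i j : B) (k : ℕ) :
    geometricRep cs (cs.wordProd (alternatingWord i j k)) (simpleRoot i) =
      if Even k then
        (S ℝ k).eval (-cartan M i j) • simpleRoot i +
          (S ℝ (k - 1)).eval (-cartan M i j) • simpleRoot j
      else
        (S ℝ (k - 1)).eval (-cartan M i j) • simpleRoot i +
          (S ℝ k).eval (-cartan M i j) • simpleRoot j := by
  induction k with
  | zero => simp [alternatingWord]
  | succ k ih =>
    have hS : (S ℝ (k + 1 : ℕ)).eval (-cartan M i j) =
        -cartan M i j * (S ℝ k).eval (-cartan M i j) - (S ℝ (k - 1)).eval (-cartan M i j) := by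
      push_cast
      rw [S_add_one]
      simp
    have hk : ((k + 1 : ℕ) : ℤ) - 1 = k := by simp
    rw [alternatingWord_succ', cs.wordProd_cons, geometricRep_mul_apply, ih, geometricRep_simple,
      hk, hS]
    by_cases hk : Even k
    · simp only [hk, if_true, Nat.even_add_one, not_true, if_false, simpleReflection_apply,
        map_add, map_smul, coroot_simpleRoot, cartan_self, cartan_symm j i]
      module
    · simp only [hk, if_true, Nat.even_add_one, not_false_eq_true, if_false,
        simpleReflection_apply, map_add, map_smul, coroot_simpleRoot, cartan_self]
      module

variable {cs}

theorem geometricRep_mul_alternatingWord_simpleRoot_nonneg {v : W} {i j : B} (hij : i ≠ j)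
    (hi : 0 ≤ geometricRep cs v (simpleRoot i)) (hj : 0 ≤ geometricRep cs v (simpleRoot j))
    {k : ℕ} (hk : M i j ≠ 0 → k + 1 ≤ M i j) :
    0 ≤ geometricRep cs (v * cs.wordProd (alternatingWord i j k)) (simpleRoot i) := by
  have hS : 0 ≤ (S ℝ k).eval (-cartan M i j) := by
    simpa using eval_S_neg_cartan_nonneg (k := k + 1) hij hk
  have hS' := eval_S_neg_cartan_nonneg hij fun h₀ => (Nat.le_succ k).trans (hk h₀)
  have hcomb {a b : ℝ} (ha : 0 ≤ a) (hb : 0 ≤ b) :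
      0 ≤ geometricRep cs v (a • simpleRoot i + b • simpleRoot j) := by
    rw [map_add, map_smul, map_smul]
    exact add_nonneg (smul_nonneg ha hi) (smul_nonneg hb hj)
  rw [geometricRep_mul_apply, geometricRep_alternatingWord_simpleRoot]
  split_ifs
  · exact hcomb hS hS'
  · exact hcomb hS' hS

theorem geometricRep_simpleRoot_nonneg_of_not_isRightDescent {w : W} {i : B}
    (hi : ¬cs.IsRightDescent w i) : 0 ≤ geometricRep cs w (simpleRoot i) := by
  induction h : cs.length w using Nat.strong_induction_on generalizing w i with
  | _ n ih =>
    subst h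
    obtain rfl | hw := eq_or_ne w 1
    · simp
    obtain ⟨j, hj⟩ := cs.exists_rightDescent_of_ne_one hw
    obtain ⟨v, k, rfl, hlen, hvi, hvj⟩ := exists_eq_mul_alternatingWord cs hi j
    have hlt : cs.length v < cs.length (v * cs.wordProd (alternatingWord i j k)) := by
      obtain rfl | hk := Nat.eq_zero_or_pos k
      · exact absurd (by simpa [alternatingWord] using hj) hvj
      · lia
    exact geometricRep_mul_alternatingWord_simpleRoot_nonneg (by rintro rfl; exact hi hj)
      (ih _ hlt hvi rfl) (ih _ hlt hvj rfl) (succ_le_of_length_mul_alternatingWord cs hi hlen)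

theorem geometricRep_simpleRoot_nonpos_of_isRightDescent {w : W} {i : B}
    (hi : cs.IsRightDescent w i) : geometricRep cs w (simpleRoot i) ≤ 0 := by
  have h := geometricRep_simpleRoot_nonneg_of_not_isRightDescent
    (cs.isRightDescent_iff_not_isRightDescent_mul.1 hi)
  rw [geometricRep_mul_simple_simpleRoot] at h
  exact neg_nonneg.1 h

theorem geometricRep_simpleRoot_nonneg_iff {w : W} {i : B} :
    0 ≤ geometricRep cs w (simpleRoot i) ↔ ¬cs.IsRightDescent w i := by
  refine ⟨fun h hi => ?_, geometricRep_simpleRoot_nonneg_of_not_isRightDescent⟩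
  have hzero := (geometricRep_simpleRoot_nonpos_of_isRightDescent hi).antisymm h
  simp at hzero

theorem eq_one_of_forall_geometricRep_simpleRoot_nonneg {w : W}
    (h : ∀ i, 0 ≤ geometricRep cs w (simpleRoot i)) : w = 1 := by
  by_contra hw
  obtain ⟨i, hi⟩ := cs.exists_rightDescent_of_ne_one hw
  exact geometricRep_simpleRoot_nonneg_iff.1 (h i) hi

end GeometricRep

section Roots

variable {cs : CoxeterSystem M W}

/-- A root is an image of a simple root under the geometric representation. It is positive when
it is `≥ 0`, that is, when its coordinates in the simple roots are nonnegative. -/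
def IsRoot (cs : CoxeterSystem M W) (γ : B →₀ ℝ) : Prop :=
  ∃ w i, geometricRep cs w (simpleRoot i) = γ

theorem IsRoot.map_geometricRep {γ : B →₀ ℝ} (h : IsRoot cs γ) (w : W) :
    IsRoot cs (geometricRep cs w γ) := by
  obtain ⟨v, i, rfl⟩ := h
  exact ⟨w * v, i, geometricRep_mul_apply cs w v _⟩

theorem IsRoot.map_simpleReflection {γ : B →₀ ℝ} (h : IsRoot cs γ) (i : B) :
    IsRoot cs (simpleReflection M i γ) := by
  simpa using h.map_geometricRep (cs.simple i)

theorem IsRoot.neg {γ : B →₀ ℝ} (h : IsRoot cs γ) : IsRoot cs (-γ) := by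
  obtain ⟨v, i, rfl⟩ := h
  exact ⟨v * cs.simple i, i, geometricRep_mul_simple_simpleRoot cs v i⟩

theorem IsRoot.nonneg_or_nonpos {γ : B →₀ ℝ} (h : IsRoot cs γ) : 0 ≤ γ ∨ γ ≤ 0 := by
  obtain ⟨v, i, rfl⟩ := h
  exact (em (cs.IsRightDescent v i)).symm.imp geometricRep_simpleRoot_nonneg_of_not_isRightDescent
    geometricRep_simpleRoot_nonpos_of_isRightDescent

theorem IsRoot.bilinForm_self {γ : B →₀ ℝ} (h : IsRoot cs γ) : bilinForm M γ γ = 2 := by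
  obtain ⟨v, i, rfl⟩ := h
  rw [bilinForm_geometricRep, bilinForm_simpleRoot, coroot_simpleRoot_self]

theorem IsRoot.eq_simpleRoot {γ : B →₀ ℝ} (h : IsRoot cs γ) {i : B} (hγ : 0 ≤ γ)
    (hi : ¬0 ≤ simpleReflection M i γ) : γ = simpleRoot i := by
  have hsγ : simpleReflection M i γ ≤ 0 :=
    (h.map_simpleReflection i).nonneg_or_nonpos.resolve_left hi
  obtain ⟨c, hc, rfl⟩ : ∃ c : ℝ, 0 ≤ c ∧ γ = c • simpleRoot i := by
    refine ⟨γ i, hγ i, Finsupp.ext fun j => ?_⟩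
    obtain rfl | hj := eq_or_ne j i
    · simp
    · have hγj := hsγ j
      rw [simpleReflection_apply_of_ne hj] at hγj
      simpa [hj.symm] using hγj.antisymm (hγ j)
  have hcc : c * (c * 2) = 2 := by
    simpa only [map_smul, LinearMap.smul_apply, bilinForm_simpleRoot, coroot_simpleRoot_self,
      smul_eq_mul] using h.bilinForm_self
  rw [show c = 1 by nlinarith, one_smul]

theorem geometricRep_simple_mul_simpleRoot_eq_neg {v : W} {i j : B}
    (hv : ¬cs.IsRightDescent v j) (hiv : cs.IsRightDescent (cs.simple i * v) j) :
    geometricRep cs (cs.simple i * v) (simpleRoot j) = -simpleRoot i := by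
  have hvj : geometricRep cs v (simpleRoot j) = simpleRoot i := by
    refine IsRoot.eq_simpleRoot ⟨v, j, rfl⟩
      (geometricRep_simpleRoot_nonneg_of_not_isRightDescent hv) ?_
    rwa [← geometricRep_simple cs, ← geometricRep_mul_apply, geometricRep_simpleRoot_nonneg_iff,
      not_not]
  rw [geometricRep_mul_apply, hvj, geometricRep_simple, simpleReflection_simpleRoot_self]

/-- The set of positive roots sent to negative roots by `w`. -/
def rootInversions (cs : CoxeterSystem M W) (w : W) : Set (B →₀ ℝ) :=
  {γ | IsRoot cs γ ∧ 0 ≤ γ ∧ ¬0 ≤ geometricRep cs w γ}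

theorem finite_rootInversions (w : W) : (rootInversions cs w).Finite := by
  induction w using cs.simple_induction_right with
  | one =>
    refine Set.finite_empty.subset fun γ ⟨_, hγ, hneg⟩ => hneg ?_
    simpa using hγ
  | mul_simple_right w i ih =>
    refine ((Set.finite_singleton (simpleRoot i)).union
      (ih.preimage (simpleReflection M i).injective.injOn)).subset fun γ ⟨hroot, hγ, hneg⟩ => ?_
    by_cases hi : 0 ≤ simpleReflection M i γ
    · rw [geometricRep_mul_apply, geometricRep_simple] at hneg
      exact Or.inr ⟨hroot.map_simpleReflection i, hi, hneg⟩
    · exact Or.inl (hroot.eq_simpleRoot hγ hi)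

end Roots

section FiniteComponents

variable {cs : CoxeterSystem M W}

/-- The set of roots with a nonzero coefficient at the simple root of index `r`. -/
def rootsThrough (cs : CoxeterSystem M W) (r : B) : Set (B →₀ ℝ) := {γ | IsRoot cs γ ∧ γ r ≠ 0}

theorem IsRoot.coroot_ne_zero_of_adj {γ : B →₀ ℝ} (h : IsRoot cs γ) {r t : B} (hr : γ r = 0)
    (ht : γ t ≠ 0) (hrt : M.diagramGraph.Adj r t) : coroot M r γ ≠ 0 := by
  obtain hγ | hγ := h.nonneg_or_nonpos
  · exact (coroot_neg_of_adj hγ hr ht hrt).ne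
  · simpa using (coroot_neg_of_adj (neg_nonneg.2 hγ) (by simpa) (by simpa) hrt).ne

theorem finite_rootsThrough_of_adj {r t : B} (hrt : M.diagramGraph.Adj r t)
    (h : (rootsThrough cs r).Finite) : (rootsThrough cs t).Finite := by
  refine (h.union (h.preimage (simpleReflection M r).injective.injOn)).subset
    fun γ ⟨hγ, ht⟩ => ?_
  by_cases hr : γ r = 0
  · refine Or.inr ⟨hγ.map_simpleReflection r, ?_⟩
    rw [simpleReflection_apply_self, hr, zero_sub, neg_ne_zero]
    exact hγ.coroot_ne_zero_of_adj hr ht hrt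
  · exact Or.inl ⟨hγ, hr⟩

theorem finite_rootsThrough_of_reachable {r t : B} (hrt : M.diagramGraph.Reachable r t)
    (h : (rootsThrough cs r).Finite) : (rootsThrough cs t).Finite := by
  obtain ⟨p⟩ := hrt
  induction p with
  | nil => exact h
  | cons hadj _ ih => exact ih (finite_rootsThrough_of_adj hadj h)

theorem finite_rootsThrough_of_forall_apply_eq_zero {r : B} {w : W}
    (h : ∀ γ, IsRoot cs γ → 0 ≤ γ → 0 ≤ geometricRep cs w γ → γ r = 0) :
    (rootsThrough cs r).Finite := by
  have hfin := finite_rootInversions (cs := cs) w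
  refine (hfin.union (hfin.preimage neg_injective.injOn)).subset fun γ ⟨hγ, hr⟩ => ?_
  obtain hpos | hneg := hγ.nonneg_or_nonpos
  · exact Or.inl ⟨hγ, hpos, fun hw => hr (h γ hγ hpos hw)⟩
  · exact Or.inr ⟨hγ.neg, neg_nonneg.2 hneg, fun hw => hr <| by
      simpa using h (-γ) hγ.neg (neg_nonneg.2 hneg) hw⟩

theorem geometricRep_apply_of_mem_standardParabolic {I : Set B} {w : W}
    (hw : w ∈ cs.standardParabolic I) {t : B} (ht : t ∉ I) (x : B →₀ ℝ) :
    geometricRep cs w x t = x t := by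
  induction hw using Subgroup.closure_induction generalizing x with
  | mem v hv =>
    obtain ⟨i, hi, rfl⟩ := hv
    rw [geometricRep_simple, simpleReflection_apply_of_ne (ne_of_mem_of_not_mem hi ht).symm]
  | one => simp
  | mul v v' _ _ h h' => rw [geometricRep_mul_apply, h, h']
  | inv v _ h => rw [← h, geometricRep_apply_inv_apply]

theorem geometricRep_simpleRoot_of_mem_standardParabolic {I : Set B} {i : B}
    (hi : ∀ j ∈ I, M j i = 2) {w : W} (hw : w ∈ cs.standardParabolic I) :
    geometricRep cs w (simpleRoot i) = simpleRoot i := by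
  induction hw using Subgroup.closure_induction with
  | mem v hv =>
    obtain ⟨j, hj, rfl⟩ := hv
    simp [simpleReflection_apply, cartan_eq_zero_of_eq_two (hi j hj)]
  | one => simp
  | mul v v' _ _ h h' => rw [geometricRep_mul_apply, h', h]
  | inv v _ h =>
    conv_lhs => rw [← h]
    rw [geometricRep_inv_apply_apply]

theorem eq_two_of_mem_supp_of_notMem_supp {C : M.diagramGraph.ConnectedComponent} {i j : B}
    (hi : i ∈ C.supp) (hj : j ∉ C.supp) : M i j = 2 := by
  by_contra hij
  exact hj (C.mem_supp_of_adj_mem_supp hi ⟨ne_of_mem_of_not_mem hi hj, hij⟩)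

variable (cs)

theorem geometricRep_simpleRoot_mem_iUnion_rootsThrough {I : Set B} {w : W}
    (hw : w ∈ cs.standardParabolic I) {i : B} (hi : i ∈ I) :
    geometricRep cs w (simpleRoot i) ∈ ⋃ r ∈ I, rootsThrough cs r := by
  by_contra hnot
  simp only [Set.mem_iUnion, not_exists] at hnot
  suffices h : geometricRep cs w (simpleRoot i) = 0 by simp at h
  ext t
  by_cases ht : t ∈ I
  · by_contra hne
    exact hnot t ht ⟨⟨w, i, rfl⟩, hne⟩
  · rw [geometricRep_apply_of_mem_standardParabolic hw ht]
    simp [ne_of_mem_of_not_mem hi ht]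

theorem finite_standardParabolic_of_finite_rootsThrough (C : M.diagramGraph.ConnectedComponent)
    [Finite C.supp] (h : ∀ r ∈ C.supp, (rootsThrough cs r).Finite) :
    Finite (cs.standardParabolic C.supp) := by
  have := ((Set.toFinite C.supp).biUnion h).to_subtype
  let f (w : cs.standardParabolic C.supp) (i : C.supp) : ⋃ r ∈ C.supp, rootsThrough cs r :=
    ⟨_, geometricRep_simpleRoot_mem_iUnion_rootsThrough cs w.2 i.2⟩
  refine Finite.of_injective f fun v w hvw => ?_
  suffices (w : W)⁻¹ * v = 1 from Subtype.ext (inv_mul_eq_one.1 this).symm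
  refine eq_one_of_forall_geometricRep_simpleRoot_nonneg (cs := cs) fun i => ?_
  suffices geometricRep cs ((w : W)⁻¹ * v) (simpleRoot i) = simpleRoot i by rw [this]; simp
  by_cases hi : i ∈ C.supp
  · have hvwi : geometricRep cs v (simpleRoot i) = geometricRep cs w (simpleRoot i) :=
      congrArg Subtype.val (congrFun hvw ⟨i, hi⟩)
    rw [geometricRep_mul_apply, hvwi, geometricRep_inv_apply_apply]
  · exact geometricRep_simpleRoot_of_mem_standardParabolic
      (fun j hj => eq_two_of_mem_supp_of_notMem_supp hj hi) (mul_mem (inv_mem w.2) v.2)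

theorem finite_standardParabolic_singleton (i : B) : Finite (cs.standardParabolic {i}) := by
  rw [CoxeterSystem.standardParabolic, Set.image_singleton, ← Subgroup.zpowers_eq_closure]
  exact (isOfFinOrder_iff_pow_eq_one.2 ⟨2, two_pos, cs.simple_sq i⟩).finite_zpowers

theorem finite_standardParabolic_of_forall_adj_apply_eq_zero {C : M.diagramGraph.ConnectedComponent}
    [Finite C.supp] {i : B} (hi : i ∈ C.supp) {w : W}
    (h : ∀ γ, IsRoot cs γ → 0 ≤ γ → 0 ≤ geometricRep cs w γ →
      ∀ r, M.diagramGraph.Adj i r → γ r = 0) :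
    Finite (cs.standardParabolic C.supp) := by
  by_cases hadj : ∃ r, M.diagramGraph.Adj i r
  · obtain ⟨r, hr⟩ := hadj
    refine finite_standardParabolic_of_finite_rootsThrough cs C fun t ht => ?_
    exact finite_rootsThrough_of_reachable (hr.reachable.symm.trans (C.reachable_of_mem_supp hi ht))
      (finite_rootsThrough_of_forall_apply_eq_zero fun γ hγ hpos hw => h γ hγ hpos hw r hr)
  · have hC : C.supp ⊆ {i} := fun t ht => by
      obtain ⟨p⟩ := C.reachable_of_mem_supp hi ht
      cases p with
      | nil => rfl
      | cons hir _ => exact absurd ⟨_, hir⟩ hadj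
    have := finite_standardParabolic_singleton cs i
    exact Set.Finite.subset this (Subgroup.closure_mono (Set.image_mono hC))

end FiniteComponents

section SkewForm

/-- The linear form `∑ j ∈ l, cartan M i j • (coordinate at α_j)`: the part of the simple coroot of
index `i` which is supported on the list `l`. -/
noncomputable def corootOn (M : CoxeterMatrix B) (i : B) (l : List B) : Module.Dual ℝ (B →₀ ℝ) :=
  (l.map fun j => cartan M i j • Finsupp.lapply j).sum

@[simp] theorem corootOn_nil (i : B) : corootOn M i [] = 0 :=
  rfl

theorem corootOn_append (i : B) (l₁ l₂ : List B) :
    corootOn M i (l₁ ++ l₂) = corootOn M i l₁ + corootOn M i l₂ := by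
  simp [corootOn]

theorem corootOn_cons (i j : B) (l : List B) :
    corootOn M i (j :: l) = cartan M i j • Finsupp.lapply j + corootOn M i l := by
  simp [corootOn]

theorem corootOn_simpleRoot_of_notMem {i j : B} {l : List B} (h : j ∉ l) :
    corootOn M i l (simpleRoot j) = 0 := by
  induction l with
  | nil => simp
  | cons k l ih =>
    rw [List.mem_cons, not_or] at h
    simp [corootOn_cons, ih h.2, h.1]

theorem corootOn_nonpos {i : B} {l : List B} (hi : i ∉ l) {x : B →₀ ℝ} (hx : 0 ≤ x) :
    corootOn M i l x ≤ 0 := by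
  induction l with
  | nil => simp
  | cons j l ih =>
    rw [List.mem_cons, not_or] at hi
    rw [corootOn_cons]
    exact add_nonpos (mul_nonpos_of_nonpos_of_nonneg (cartan_nonpos hi.1) (hx j)) (ih hi.2)

theorem corootOn_neg_of_adj {i r : B} {l : List B} (hi : i ∉ l) (hrl : r ∈ l) {x : B →₀ ℝ}
    (hx : 0 ≤ x) (hr : x r ≠ 0) (hir : M.diagramGraph.Adj i r) : corootOn M i l x < 0 := by
  obtain ⟨l₁, l₂, rfl⟩ := List.append_of_mem hrl
  rw [List.mem_append, List.mem_cons, not_or, not_or] at hi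
  have h₁ := corootOn_nonpos (M := M) hi.1 hx
  have h₂ := corootOn_nonpos (M := M) hi.2.2 hx
  have h₃ := mul_neg_of_neg_of_pos (cartan_neg_of_adj hir) ((hx r).lt_of_ne' hr)
  simp only [corootOn_append, corootOn_cons, LinearMap.add_apply, LinearMap.smul_apply,
    Finsupp.lapply_apply, smul_eq_mul]
  linarith

theorem coroot_eq_corootOn {i : B} {l : List B} (hl : l.Nodup) (hmem : ∀ j, j ∈ l) :
    coroot M i = corootOn M i l := by
  classical
  ext j
  have hj := List.perm_cons_erase (hmem j)
  have hnot : j ∉ l.erase j := ((hj.nodup_iff).1 hl).notMem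
  have hsum : corootOn M i l = corootOn M i (j :: l.erase j) := (hj.map _).sum_eq
  simp [hsum, corootOn_cons, corootOn_simpleRoot_of_notMem hnot]

theorem coroot_eq_add_corootOn {i : B} {l : List B} (hl : (i :: l).Nodup)
    (hmem : ∀ j, j ∈ i :: l) (x : B →₀ ℝ) : coroot M i x = 2 * x i + corootOn M i l x := by
  rw [coroot_eq_corootOn hl hmem, corootOn_cons]
  simp

/-- The skew-symmetric form attached to a list `l` of indices: for `j` before `k` in `l`, its value
on `(α_j, α_k)` is `-cartan M j k`. For an enumeration of the index set it is the
antisymmetrized Euler form of the corresponding Coxeter element. -/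
noncomputable def skewForm (M : CoxeterMatrix B) : List B → LinearMap.BilinForm ℝ (B →₀ ℝ)
  | [] => 0
  | i :: l => (corootOn M i l).smulRight (Finsupp.lapply i) -
      (Finsupp.lapply i : Module.Dual ℝ (B →₀ ℝ)).smulRight (corootOn M i l) + skewForm M l

theorem skewForm_cons (i : B) (l : List B) (x y : B →₀ ℝ) :
    skewForm M (i :: l) x y =
      corootOn M i l x * y i - x i * corootOn M i l y + skewForm M l x y := by
  simp [skewForm]

theorem skewForm_concat (l : List B) (i : B) (x y : B →₀ ℝ) :
    skewForm M (l ++ [i]) x y =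
      skewForm M l x y + (x i * corootOn M i l y - corootOn M i l x * y i) := by
  induction l with
  | nil => simp [skewForm]
  | cons j l ih =>
    simp only [List.cons_append, skewForm_cons, ih, corootOn_append, corootOn_cons,
      corootOn_nil, LinearMap.add_apply, LinearMap.smul_apply, LinearMap.zero_apply,
      Finsupp.lapply_apply, smul_eq_mul, cartan_symm j i]
    ring

theorem skewForm_simpleRoot_left_of_notMem {i : B} {l : List B} (hi : i ∉ l) :
    skewForm M l (simpleRoot i) = 0 := by
  induction l with
  | nil => rfl
  | cons j l ih =>
    rw [List.mem_cons, not_or] at hi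
    refine LinearMap.ext fun y => ?_
    simp [skewForm_cons, ih hi.2, corootOn_simpleRoot_of_notMem hi.2, hi.1]

theorem skewForm_simpleReflection_left_of_notMem {i : B} {l : List B} (hi : i ∉ l) (x : B →₀ ℝ) :
    skewForm M l (simpleReflection M i x) = skewForm M l x := by
  rw [simpleReflection_apply, map_sub, map_smul, skewForm_simpleRoot_left_of_notMem hi, smul_zero,
    sub_zero]

theorem skewForm_swap (l : List B) (x y : B →₀ ℝ) : skewForm M l y x = -skewForm M l x y := by
  induction l with
  | nil => simp [skewForm]
  | cons i l ih =>
    rw [skewForm_cons, skewForm_cons, ih]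
    ring

theorem skewForm_cons_simpleRoot_left {i : B} {l : List B} (hi : i ∉ l) (y : B →₀ ℝ) :
    skewForm M (i :: l) (simpleRoot i) y = -corootOn M i l y := by
  rw [skewForm_cons, skewForm_simpleRoot_left_of_notMem hi, corootOn_simpleRoot_of_notMem hi]
  simp

theorem corootOn_simpleReflection {i : B} {l : List B} (hi : i ∉ l) (x : B →₀ ℝ) :
    corootOn M i l (simpleReflection M i x) = corootOn M i l x := by
  rw [simpleReflection_apply, map_sub, map_smul, corootOn_simpleRoot_of_notMem hi, smul_zero,
    sub_zero]

theorem skewForm_concat_simpleReflection {i : B} {l : List B} (hl : (i :: l).Nodup)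
    (hmem : ∀ j, j ∈ i :: l) (x y : B →₀ ℝ) :
    skewForm M (l ++ [i]) (simpleReflection M i x) (simpleReflection M i y) =
      skewForm M (i :: l) x y := by
  have hi : i ∉ l := hl.notMem
  have hskew : skewForm M l (simpleReflection M i x) (simpleReflection M i y) =
      skewForm M l x y := by
    rw [skewForm_simpleReflection_left_of_notMem hi, skewForm_swap,
      skewForm_simpleReflection_left_of_notMem hi, ← skewForm_swap]
  rw [skewForm_concat, hskew, skewForm_cons, corootOn_simpleReflection hi,
    corootOn_simpleReflection hi, simpleReflection_apply_self, simpleReflection_apply_self,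
    coroot_eq_add_corootOn hl hmem, coroot_eq_add_corootOn hl hmem]
  ring

variable {cs : CoxeterSystem M W}

end SkewForm

section CyclicWords

/-- The prefix of length `k` of the infinite periodic word `l ++ l ++ l ++ ⋯`, or the empty word if
`l` is empty. -/
def cyclicWord {α : Type*} : List α → ℕ → List α
  | _, 0 => []
  | [], _ => []
  | i :: l, k + 1 => i :: cyclicWord (l ++ [i]) k

section List

variable {α : Type*}

@[simp] theorem cyclicWord_zero (l : List α) : cyclicWord l 0 = [] := by
  cases l <;> rfl

theorem cyclicWord_cons_succ (i : α) (l : List α) (k : ℕ) :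
    cyclicWord (i :: l) (k + 1) = i :: cyclicWord (l ++ [i]) k :=
  rfl

theorem cyclicWord_succ_of_rotate_eq_cons {l l' : List α} {j : α} {k : ℕ}
    (h : l.rotate k = j :: l') : cyclicWord l (k + 1) = cyclicWord l k ++ [j] := by
  induction k generalizing l with
  | zero =>
    rw [List.rotate_zero] at h
    simp [h, cyclicWord_cons_succ]
  | succ k ih =>
    cases l with
    | nil => simp at h
    | cons i l =>
      rw [List.rotate_cons_succ] at h
      rw [cyclicWord_cons_succ, ih h, cyclicWord_cons_succ, List.cons_append]

theorem cyclicWord_append_length_add (l₁ l₂ : List α) (k : ℕ) :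
    cyclicWord (l₁ ++ l₂) (l₁.length + k) = l₁ ++ cyclicWord (l₂ ++ l₁) k := by
  induction l₁ generalizing l₂ with
  | nil => simp
  | cons i l ih =>
    rw [List.cons_append, List.length_cons, Nat.add_right_comm, cyclicWord_cons_succ,
      List.append_assoc, ih]
    simp

theorem cyclicWord_mul_length (l : List α) (m : ℕ) :
    cyclicWord l (m * l.length) = (List.replicate m l).flatten := by
  induction m with
  | zero => simp
  | succ m ih =>
    have hstep := cyclicWord_append_length_add l [] (m * l.length)
    rw [List.append_nil, List.nil_append, ih] at hstep
    rw [Nat.succ_mul, Nat.add_comm, hstep, List.replicate_succ, List.flatten_cons]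

end List

variable {cs : CoxeterSystem M W}

theorem skewForm_cyclicWord {l : List B} (hl : l.Nodup) (hmem : ∀ i, i ∈ l) (k : ℕ)
    (x y : B →₀ ℝ) :
    skewForm M l (geometricRep cs (cs.wordProd (cyclicWord l k)) x)
      (geometricRep cs (cs.wordProd (cyclicWord l k)) y) = skewForm M (l.rotate k) x y := by
  induction k generalizing l with
  | zero => simp
  | succ k ih =>
    cases l with
    | nil => simp [cyclicWord]
    | cons i l =>
      have hperm : (l ++ [i]).Perm (i :: l) := List.perm_append_singleton i l
      rw [cyclicWord_cons_succ, cs.wordProd_cons, geometricRep_mul_apply, geometricRep_mul_apply,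
        geometricRep_simple, ← skewForm_concat_simpleReflection hl hmem,
        simpleReflection_simpleReflection, simpleReflection_simpleReflection,
        ih (hperm.nodup_iff.2 hl) fun t => hperm.mem_iff.2 (hmem t), List.rotate_cons_succ]

theorem finite_standardParabolic_of_skewForm_eq {i j : B} {l l' : List B} (hi : i ∉ l)
    (hmem : ∀ r, r ∈ i :: l) (hj : j ∉ l') {w : W}
    (hw : geometricRep cs w (simpleRoot j) = -simpleRoot i)
    (hskew : ∀ x y, skewForm M (i :: l) (geometricRep cs w x) (geometricRep cs w y) =
      skewForm M (j :: l') x y) :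
    Finite (cs.standardParabolic (M.diagramGraph.connectedComponentMk i).supp) := by
  have : Finite B := Finite.of_finite_univ ((i :: l).finite_toSet.subset fun r _ => hmem r)
  refine finite_standardParabolic_of_forall_adj_apply_eq_zero cs rfl (w := w⁻¹)
    fun γ _ hγ hwγ r hir => ?_
  by_contra hr
  have hneg : corootOn M i l γ < 0 :=
    corootOn_neg_of_adj hi (List.mem_of_ne_of_mem hir.1.symm (hmem r)) hγ hr hir
  have hnonpos : corootOn M j l' (geometricRep cs w⁻¹ γ) ≤ 0 := corootOn_nonpos hj hwγ
  have heq := hskew (simpleRoot j) (geometricRep cs w⁻¹ γ)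
  rw [hw, geometricRep_apply_inv_apply, map_neg, LinearMap.neg_apply,
    skewForm_cons_simpleRoot_left hi, skewForm_cons_simpleRoot_left hj] at heq
  linarith

theorem isReduced_cyclicWord (h : cs.HasOnlyInfiniteComponents) {l : List B} (hl : l.Nodup)
    (hmem : ∀ i, i ∈ l) (k : ℕ) : cs.IsReduced (cyclicWord l k) := by
  induction k generalizing l with
  | zero => simp [CoxeterSystem.IsReduced]
  | succ k ih =>
    obtain _ | ⟨i, l⟩ := l
    · simp [CoxeterSystem.IsReduced, cyclicWord]
    have hperm : (l ++ [i]).Perm (i :: l) := List.perm_append_singleton i l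
    obtain ⟨j, l', hrot⟩ : ∃ j l', (i :: l).rotate k = j :: l' :=
      List.exists_cons_of_ne_nil (by simp)
    rw [cyclicWord_succ_of_rotate_eq_cons hrot, isReduced_concat_iff]
    refine ⟨ih hl hmem, fun hdesc => ?_⟩
    obtain _ | k := k
    · exact cs.not_isRightDescent_one j (by simpa using hdesc)
    have hrot' : (l ++ [i]).rotate k = j :: l' := by rwa [List.rotate_cons_succ] at hrot
    have htail := ih (hperm.nodup_iff.2 hl) fun t => hperm.mem_iff.2 (hmem t)
    rw [cyclicWord_succ_of_rotate_eq_cons hrot', isReduced_concat_iff] at htail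
    have hskew := skewForm_cyclicWord (cs := cs) hl hmem (k + 1)
    rw [hrot, cyclicWord_cons_succ, cs.wordProd_cons] at hskew
    rw [cyclicWord_cons_succ, cs.wordProd_cons] at hdesc
    have hj : j ∉ l' := (hrot ▸ List.nodup_rotate.2 hl : (j :: l').Nodup).notMem
    exact not_finite_iff_infinite.2 (h _) <| finite_standardParabolic_of_skewForm_eq hl.notMem hmem
      hj (geometricRep_simple_mul_simpleRoot_eq_neg htail.2 hdesc) hskew

end CyclicWords

section CoxeterElements

variable (cs : CoxeterSystem M W)

theorem isReduced_of_nodup {l : List B} (hl : l.Nodup) : cs.IsReduced l := by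
  induction l using List.reverseRecOn with
  | nil => simp [CoxeterSystem.IsReduced]
  | append_singleton l i ih =>
    rw [List.nodup_append_comm, List.singleton_append, List.nodup_cons] at hl
    rw [isReduced_concat_iff]
    refine ⟨ih hl.2, fun hdesc => ?_⟩
    have hcoord : geometricRep cs (cs.wordProd l) (simpleRoot i) i = 1 := by
      rw [geometricRep_apply_of_mem_standardParabolic (wordProd_mem_standardParabolic cs l) hl.1]
      simp
    have hneg := geometricRep_simpleRoot_nonpos_of_isRightDescent hdesc i
    rw [hcoord] at hneg
    exact one_pos.not_ge hneg

theorem commute_simple_of_eq_two {i j : B} (h : M i j = 2) :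
    Commute (cs.simple i) (cs.simple j) := by
  have hpow := cs.simple_mul_simple_pow i j
  rwa [h, pow_two, mul_eq_one_iff_eq_inv, mul_inv_rev, cs.inv_simple, cs.inv_simple] at hpow

theorem commute_wordProd_of_forall_eq_two {ω ω' : List B}
    (h : ∀ i ∈ ω, ∀ j ∈ ω', M i j = 2) : Commute (cs.wordProd ω) (cs.wordProd ω') := by
  refine Commute.list_prod_left _ _ fun x hx => Commute.list_prod_right _ _ fun y hy => ?_
  obtain ⟨i, hi, rfl⟩ := List.mem_map.1 hx
  obtain ⟨j, hj, rfl⟩ := List.mem_map.1 hy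
  exact commute_simple_of_eq_two cs (h i hi j hj)

theorem wordProd_eq_wordProd_filter_mul {I : Set B} [DecidablePred (· ∈ I)]
    (hI : ∀ i ∈ I, ∀ j ∉ I, M i j = 2) (ω : List B) :
    cs.wordProd ω = cs.wordProd (ω.filter (· ∈ I)) * cs.wordProd (ω.filter (· ∉ I)) := by
  induction ω with
  | nil => simp
  | cons i ω ih =>
    rw [cs.wordProd_cons, ih]
    by_cases hi : i ∈ I
    · rw [List.filter_cons_of_pos (by simpa), List.filter_cons_of_neg (by simpa),
        cs.wordProd_cons, mul_assoc]
    · have hcomm : Commute (cs.wordProd (ω.filter (· ∈ I))) (cs.simple i) := by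
        rw [← cs.wordProd_singleton]
        refine commute_wordProd_of_forall_eq_two cs fun j hj k hk => hI j ?_ k ?_
        · simpa using (List.mem_filter.1 hj).2
        · rwa [List.mem_singleton.1 hk]
      rw [List.filter_cons_of_neg (by simpa), List.filter_cons_of_pos (by simpa),
        cs.wordProd_cons, ← mul_assoc, ← mul_assoc, hcomm.eq]

theorem wordProd_pow_card_eq_wordProd_filter_pow {I : Set B} [DecidablePred (· ∈ I)]
    (hI : ∀ i ∈ I, ∀ j ∉ I, M i j = 2) (ω : List B) :
    cs.wordProd ω ^ Nat.card (cs.standardParabolic I) =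
      cs.wordProd (ω.filter (· ∉ I)) ^ Nat.card (cs.standardParabolic I) := by
  have hcomm : Commute (cs.wordProd (ω.filter (· ∈ I))) (cs.wordProd (ω.filter (· ∉ I))) :=
    commute_wordProd_of_forall_eq_two cs fun i hi j hj =>
      hI i (by simpa using (List.mem_filter.1 hi).2) j (by simpa using (List.mem_filter.1 hj).2)
  have hmem : cs.wordProd (ω.filter (· ∈ I)) ∈ cs.standardParabolic I :=
    Subgroup.closure_mono (Set.image_mono fun i hi => by simpa using (List.mem_filter.1 hi).2)
      (wordProd_mem_standardParabolic cs _)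
  have hcard : cs.wordProd (ω.filter (· ∈ I)) ^ Nat.card (cs.standardParabolic I) = 1 :=
    congrArg Subtype.val (pow_card_eq_one' (x := (⟨_, hmem⟩ : cs.standardParabolic I)))
  rw [wordProd_eq_wordProd_filter_mul cs hI ω, hcomm.mul_pow, hcard, one_mul]

theorem notMem_of_isStraight_wordProd {I : Set B} [Finite (cs.standardParabolic I)]
    (hI : ∀ i ∈ I, ∀ j ∉ I, M i j = 2) {ω : List B} (hω : cs.IsReduced ω)
    (h : cs.IsStraight (cs.wordProd ω)) {i : B} (hi : i ∈ ω) : i ∉ I := by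
  classical
  intro hiI
  have hlt : (ω.filter (· ∉ I)).length < ω.length :=
    List.length_filter_lt_length_iff_exists.2 ⟨i, hi, by simpa⟩
  set m := Nat.card (cs.standardParabolic I) with hm
  have hpow : m * ω.length ≤ m * (ω.filter (· ∉ I)).length :=
    calc m * ω.length = cs.length (cs.wordProd ω ^ m) := by rw [h m, hω]
      _ = cs.length (cs.wordProd (List.replicate m (ω.filter (· ∉ I))).flatten) := by
        rw [wordProd_flatten_replicate, hm, wordProd_pow_card_eq_wordProd_filter_pow cs hI]
      _ ≤ _ := cs.length_wordProd_le _
      _ = m * (ω.filter (· ∉ I)).length := by simp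
  exact (Nat.le_of_mul_le_mul_left hpow Nat.card_pos).not_gt hlt

end CoxeterElements

end GeometricRepresentation

theorem mainTheorem6 {B W : Type*} [Group W] {M : CoxeterMatrix B} (cs : CoxeterSystem M W)
    (u : W) (hu : cs.IsCoxeterElement u) :
    cs.IsStraight u ↔ cs.HasOnlyInfiniteComponents := by
  obtain ⟨l, hl, hmem, rfl⟩ := hu
  have hred : cs.IsReduced l := GeometricRepresentation.isReduced_of_nodup cs hl
  constructor
  · intro h C
    by_contra hfin
    rw [not_infinite_iff_finite] at hfin
    obtain ⟨i, hi⟩ := C.nonempty_supp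
    exact GeometricRepresentation.notMem_of_isStraight_wordProd cs
      (fun _ hj _ hk => GeometricRepresentation.eq_two_of_mem_supp_of_notMem_supp hj hk)
      hred h (hmem i) hi
  · intro h m
    have hpow : cs.IsReduced (List.replicate m l).flatten := by
      rw [← GeometricRepresentation.cyclicWord_mul_length]
      exact GeometricRepresentation.isReduced_cyclicWord h hl hmem (m * l.length)
    rw [← GeometricRepresentation.wordProd_flatten_replicate, hpow, hred]
    simp
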